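/- Let $n\ge 0$ and let $\langle\cdot,\cdot\rangle$ be the standard scalar product on $\mathbb R^n$. A rational (resp. lattice) polytope is the convex hull of finitely many points of $\mathbb Q^n$ (resp. $\mathbb Z^n$). A rational polytope $P\subset\mathbb R^n$ containing $0$ in its interior has a unique representation $$P=\{p\in\mathbb R^n:\ \langle l_F,p\rangle\ge -a_F \text{ for every facet } F \text{ of } P\},\qquad F=\{p\in P:\ \langle l_F,p\rangle=-a_F\},$$ where each $l_F\in\mathbb Z^n$ is primitive (its coordinates have no common factor) and each $a_F$ is a positive rational number. The dual of a set $Q\subset\mathbb R^n$ is $Q^*=\{p\in\mathbb R^n:\ \langle q,p\rangle\ge -1 \text{ for all } q\in Q\}$, and a lattice polytope containing $0$ is called reflexive if its dual is also a lattice polytope. **Corollary.** (i) Let $P\subset\mathbb R^n$ be a rational polytope containing $0$ in its interior, such that $a_F\le 1$ for every facet $F$ and such that $0$ is the barycenter of $P$. Then $$\operatorname{Vol}(P)\le\frac{(n+1)^n}{n!}.$$ (ii) In particular, the same bound holds for $P=Q^*$ whenever $Q\subset\mathbb R^n$ is a lattice polytope containing $0$ in its interior and $0$ is the barycenter of $Q^*$.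 (iii) In particular, the same bound holds for every reflexive polytope $P\subset\mathbb R^n$ whose barycenter is $0$. -/

import Mathlib

open MeasureTheory

namespace Ehrhart

/-- The standard pairing `⟨l, p⟩` of an integer vector with a point of `ℝⁿ`. -/
def pairing {n : ℕ} (l : Fin n → ℤ) (p : Fin n → ℝ) : ℝ :=
  ∑ i, (l i : ℝ) * p i

/-- A primitive lattice vector: its integer coordinates have no common factor. -/
def IsPrimitive {n : ℕ} (l : Fin n → ℤ) : Prop :=
  Finset.univ.gcd l = 1

/-- A rational polytope: the convex hull of finitely many points with rational coordinates. -/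
def IsRationalPolytope {n : ℕ} (P : Set (Fin n → ℝ)) : Prop :=
  ∃ S : Finset (Fin n → ℚ), P = convexHull ℝ ((fun v i => (v i : ℝ)) '' (S : Set (Fin n → ℚ)))

/-- A lattice polytope: the convex hull of finitely many points with integer coordinates. -/
def IsLatticePolytope {n : ℕ} (P : Set (Fin n → ℝ)) : Prop :=
  ∃ S : Finset (Fin n → ℤ), P = convexHull ℝ ((fun v i => (v i : ℝ)) '' (S : Set (Fin n → ℤ)))

/-- A facet of an `n`-dimensional polytope `P ⊆ ℝⁿ`: a nonempty (exposed) face of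
dimension `n - 1`. -/
structure IsFacet {n : ℕ} (P F : Set (Fin n → ℝ)) : Prop where
  nonempty : F.Nonempty
  exposed : IsExposed ℝ P F
  dim : Module.finrank ℝ (vectorSpan ℝ F) + 1 = n

/-- `l` is the primitive inward normal `l_F` and `a` the constant `a_F` of the facet `F` of `P`:
`P` lies in the half-space `⟨l, p⟩ ≥ -a`, and `F` is the part of `P` on its boundary. -/
structure IsFacetDatum {n : ℕ} (P F : Set (Fin n → ℝ)) (l : Fin n → ℤ) (a : ℚ) : Prop where
  facet : IsFacet P F
  primitive : IsPrimitive l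
  halfspace : ∀ p ∈ P, -(a : ℝ) ≤ pairing l p
  boundary : F = {p ∈ P | pairing l p = -(a : ℝ)}

/-- The barycenter `Vol(P)⁻¹ ∫_P p dp`, with respect to Lebesgue measure. -/
noncomputable def barycenter {n : ℕ} (P : Set (Fin n → ℝ)) : Fin n → ℝ :=
  ⨍ p in P, p ∂volume

/-- The dual (polar) `Q* = {p : ⟨q, p⟩ ≥ -1 for all q ∈ Q}`. -/
def dual {n : ℕ} (Q : Set (Fin n → ℝ)) : Set (Fin n → ℝ) :=
  {p | ∀ q ∈ Q, -1 ≤ ∑ i, q i * p i}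

/-- A reflexive polytope: a lattice polytope containing `0` whose dual is a lattice polytope. -/
structure IsReflexive {n : ℕ} (P : Set (Fin n → ℝ)) : Prop where
  lattice : IsLatticePolytope P
  zero_mem : 0 ∈ P
  dual_lattice : IsLatticePolytope (dual P)

/-- The bound `Vol(P) ≤ (n + 1)ⁿ / n!`. -/
def VolumeBound {n : ℕ} (P : Set (Fin n → ℝ)) : Prop :=
  volume P ≤ ENNReal.ofReal (((n : ℝ) + 1) ^ n / (n.factorial : ℝ))

end Ehrhart

/-!
The proof counts Laurent polynomials in characteristic `2`. For a large dilate `k • P`, let `W` be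
the set of its lattice points, `N = #W`, and consider the polynomials over `𝔽₂` with exponents in
`W`. Vanishing to order `t` at the point `(1, …, 1)` of the torus imposes at most
`(t - 1 + n).choose n` linear conditions (`exists_finset_span_sup_vanishing`). Order `ℤⁿ`
lexicographically: a space of polynomials of dimension `d` has at least `d` leading exponents
(`finrank_le_card_leadingExponents`). Hence one can choose, for every `m ∈ W`, a polynomial with
leading exponent `m`, in such a way that the orders of vanishing sum to at least
`T * N - (T + n).choose (n + 1)`, for any given `T` (`mul_card_le_sum_jump_add`).

The product `f` of these `N` polynomials has its Newton polytope in `k N • P` and leading exponent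
`∑ m ∈ W, m`, which is `o(k N)` since the barycenter is `0`. Such an `f` cannot vanish to order much
more than `n k N` (`vanishing_order_le`). Indeed, if `q = 2 ^ e`, a polynomial vanishing to order
`n q` lies in the ideal of the `xᵢ ^ q - 1`, i.e. it becomes `0` when exponents are reduced
modulo `q`. Apply this to `f ^ c` for `c` slightly smaller than `q / (k N)`. If `m + q u`, where `m`
is the leading exponent of `f ^ c`, is another exponent of `f ^ c`, then `⟨l, u⟩ > -1`, so
`⟨l, u⟩ ≥ 0`, for all integral forms `l` with `l ≥ -1` on `P`. If these forms are not all nonnegative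
at any nonzero lattice point, then `u = 0`: the leading term survives the reduction, and `f ^ c`
vanishes to order less than `n q`.

Comparing the two bounds for `T = (n + 1) k`, dividing by `k ^ (n + 1)` and letting `k → ∞` gives
`(n + 1) Vol P - (n + 1) ^ (n + 1) / (n + 1)! ≤ n Vol P`, which is the claim
(`volumeBound_of_forms`).

The integral forms are the primitive normals of the facets in the first case
(`exists_isFacetDatum_pairing_neg`, where `a ≤ 1` gives `l ≥ -1` on `P`), and the lattice points
spanning the dual polytope in the other two (`volumeBound_of_subset_dual`).
-/

namespace Ehrhart

open Filter Topology
open AddMonoidAlgebra (single)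

/-! ### Vanishing order at the unit point of the torus -/

section Algebra

/-- Laurent polynomials in `n` variables over `K`: the group algebra of `ℤⁿ`. -/
abbrev Laurent (K : Type*) [Field K] (n : ℕ) := AddMonoidAlgebra K (Fin n → ℤ)

variable {K : Type*} [Field K] {n : ℕ}

/-- The function `xᵢ - 1`; these are local parameters of the torus at `(1, …, 1)`. -/
noncomputable def param (K : Type*) [Field K] {n : ℕ} (i : Fin n) : Laurent K n :=
  single (Pi.single i 1) 1 - 1

/-- The maximal ideal of the point `(1, …, 1)` of the torus. Its power `unitIdeal K n ^ t` consists
of the Laurent polynomials vanishing to order at least `t` at that point. -/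
noncomputable def unitIdeal (K : Type*) [Field K] (n : ℕ) : Ideal (Laurent K n) :=
  Ideal.span (Set.range (param K))

lemma single_sub_one_mem_unitIdeal (m : Fin n → ℤ) :
    (single m 1 - 1 : Laurent K n) ∈ unitIdeal K n := by
  let H : AddSubgroup (Fin n → ℤ) :=
    { carrier := {m | (single m 1 - 1 : Laurent K n) ∈ unitIdeal K n}
      zero_mem' := by
        simp [← AddMonoidAlgebra.one_def]
      add_mem' := by
        intro a b ha hb
        have : (single (a + b) 1 - 1 : Laurent K n)
            = single a 1 * (single b 1 - 1) + (single a 1 - 1) := by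
          rw [mul_sub, AddMonoidAlgebra.single_mul_single]; simp
        simp only [Set.mem_ofPred_eq] at *
        rw [this]
        exact add_mem (Ideal.mul_mem_left _ _ hb) ha
      neg_mem' := by
        intro a ha
        have : (single (-a) 1 - 1 : Laurent K n) = -single (-a) 1 * (single a 1 - 1) := by
          rw [mul_sub, neg_mul, AddMonoidAlgebra.single_mul_single]
          simp [← AddMonoidAlgebra.one_def, sub_eq_add_neg, add_comm]
        simp only [Set.mem_ofPred_eq] at *
        rw [this]
        exact Ideal.mul_mem_left _ _ ha }
  have hm : m = ∑ i, m i • (Pi.single i 1 : Fin n → ℤ) := by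
    ext j; simp [Finset.sum_apply, Pi.single_apply]
  change m ∈ H
  rw [hm]
  refine AddSubgroup.sum_mem _ fun i _ => AddSubgroup.zsmul_mem _ ?_ _
  exact Ideal.subset_span (Set.mem_range_self (f := param K) i)

/-- Modulo the ideal of `(1, …, 1)`, every Laurent polynomial is a constant. -/
lemma exists_sub_algebraMap_mem_unitIdeal (f : Laurent K n) :
    ∃ c : K, f - algebraMap K _ c ∈ unitIdeal K n := by
  induction f using AddMonoidAlgebra.induction_on with
  | of m =>
    refine ⟨1, ?_⟩
    simpa [AddMonoidAlgebra.one_def] using single_sub_one_mem_unitIdeal m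
  | add f g hf hg =>
    obtain ⟨c, hc⟩ := hf
    obtain ⟨d, hd⟩ := hg
    refine ⟨c + d, ?_⟩
    convert! add_mem hc hd using 1
    rw [map_add]; ring
  | smul r f hf =>
    obtain ⟨c, hc⟩ := hf
    refine ⟨r * c, ?_⟩
    convert! Ideal.mul_mem_left _ (algebraMap K _ r) hc using 1
    rw [map_mul, mul_sub, Algebra.smul_def]

/-- The span of the local parameters; it represents the cotangent space at `(1, …, 1)`. -/
noncomputable def paramSpan (K : Type*) [Field K] (n : ℕ) : Submodule K (Laurent K n) :=
  Submodule.span K (Set.range (param K))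

/-- The powers of the maximal ideal as `K`-subspaces. -/
noncomputable abbrev vanishing (K : Type*) [Field K] (n t : ℕ) : Submodule K (Laurent K n) :=
  (unitIdeal K n ^ t).restrictScalars K

lemma vanishing_one_le : vanishing K n 1 ≤ paramSpan K n ⊔ vanishing K n 2 := by
  intro f hf
  have hf' : f ∈ unitIdeal K n := by simpa using hf
  rw [unitIdeal] at hf'
  induction hf' using Submodule.span_induction with
  | mem x hx => exact Submodule.mem_sup_left (Submodule.subset_span hx)
  | zero => exact zero_mem _
  | add x y hx hy ihx ihy =>
    exact add_mem (ihx (by simpa [unitIdeal] using hx)) (ihy (by simpa [unitIdeal] using hy))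
  | smul a x hx ih =>
    have hxI : x ∈ unitIdeal K n := hx
    obtain ⟨c, hc⟩ := exists_sub_algebraMap_mem_unitIdeal a
    have : a • x = (a - algebraMap K _ c) * x + c • x := by
      rw [Algebra.smul_def c x, smul_eq_mul]; ring
    rw [this]
    refine add_mem (Submodule.mem_sup_right ?_) (Submodule.smul_mem _ _ (ih (by simpa using hxI)))
    change _ ∈ unitIdeal K n ^ 2
    rw [pow_two]
    exact Ideal.mul_mem_mul hc hxI

/-- The associated graded pieces `I ^ t / I ^ (t + 1)` are spanned by the monomials of degree `t`
in the local parameters. -/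
lemma vanishing_le (t : ℕ) :
    vanishing K n t ≤ paramSpan K n ^ t ⊔ vanishing K n (t + 1) := by
  induction t with
  | zero =>
    intro f _
    obtain ⟨c, hc⟩ := exists_sub_algebraMap_mem_unitIdeal f
    rw [← add_sub_cancel (algebraMap K _ c) f]
    refine add_mem (Submodule.mem_sup_left ?_) (Submodule.mem_sup_right (by simpa using hc))
    rw [pow_zero]
    exact Submodule.algebraMap_mem c
  | succ t ih =>
    intro f hf
    replace hf : f ∈ unitIdeal K n ^ (t + 1) := hf
    rw [pow_succ] at hf
    induction hf using Submodule.mul_induction_on' with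
    | add x _ y _ hx hy => exact add_mem hx hy
    | mem_mul_mem a ha b hb =>
      obtain ⟨a₁, ha₁, a₂, ha₂, rfl⟩ := Submodule.mem_sup.1 (ih ha)
      obtain ⟨b₁, hb₁, b₂, hb₂, rfl⟩ := Submodule.mem_sup.1
        (vanishing_one_le (K := K) (n := n) (by simpa using hb))
      replace ha₂ : a₂ ∈ unitIdeal K n ^ (t + 1) := ha₂
      replace hb₂ : b₂ ∈ unitIdeal K n ^ 2 := hb₂
      have h : (a₁ + a₂) * (b₁ + b₂) = a₁ * b₁ + (a₂ * (b₁ + b₂) + ((a₁ + a₂) * b₂ - a₂ * b₂)) := by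
        ring
      rw [h]
      refine add_mem (Submodule.mem_sup_left ?_) (Submodule.mem_sup_right ?_)
      · rw [pow_succ]; exact Submodule.mul_mem_mul ha₁ hb₁
      · change _ ∈ unitIdeal K n ^ (t + 1 + 1)
        refine add_mem ?_ (sub_mem ?_ ?_)
        · rw [pow_succ]; exact Ideal.mul_mem_mul ha₂ hb
        · rw [show t + 1 + 1 = t + 2 from rfl, pow_add]; exact Ideal.mul_mem_mul ha hb₂
        · rw [show t + 1 + 1 = t + 2 from rfl, pow_add]
          exact Ideal.mul_mem_mul (Ideal.pow_le_pow_right (Nat.le_succ t) ha₂) hb₂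

open scoped Pointwise in
lemma exists_finset_span_eq_paramSpan_pow (t : ℕ) :
    ∃ E : Finset (Laurent K n), E.card ≤ n.multichoose t ∧
      paramSpan K n ^ t ≤ Submodule.span K E := by
  classical
  refine ⟨Finset.univ.image fun s : Sym (Fin n) t => ((s : Multiset (Fin n)).map (param K)).prod,
    ?_, ?_⟩
  · refine Finset.card_image_le.trans ?_
    rw [Finset.card_univ, Sym.card_sym_eq_multichoose, Fintype.card_fin]
  · rw [paramSpan, Submodule.span_pow]
    refine Submodule.span_mono ?_
    rw [Finset.coe_image, Finset.coe_univ, Set.image_univ]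
    induction t with
    | zero => rintro f hf; exact ⟨Sym.nil, by simpa using (Set.mem_one.1 hf).symm⟩
    | succ t ih =>
      rw [pow_succ]
      rintro _ ⟨f, hf, _, ⟨i, rfl⟩, rfl⟩
      obtain ⟨s, rfl⟩ := ih hf
      exact ⟨i ::ₛ s, by simp [Sym.coe_cons, mul_comm]⟩

/-- The local ring at `(1, …, 1)` modulo functions vanishing to order `t` has dimension at most
`∑ s < t, multichoose n s`. -/
lemma exists_finset_span_sup_vanishing (t : ℕ) :
    ∃ E : Finset (Laurent K n), E.card ≤ ∑ s ∈ Finset.range t, n.multichoose s ∧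
      ⊤ ≤ Submodule.span K (E : Set (Laurent K n)) ⊔ vanishing K n t := by
  classical
  induction t with
  | zero => exact ⟨∅, by simp, fun f _ => Submodule.mem_sup_right (by simp)⟩
  | succ t ih =>
    obtain ⟨E, hE, hE'⟩ := ih
    obtain ⟨D, hD, hD'⟩ := exists_finset_span_eq_paramSpan_pow (K := K) (n := n) t
    refine ⟨E ∪ D, ?_, ?_⟩
    · rw [Finset.sum_range_succ]
      exact (Finset.card_union_le _ _).trans (add_le_add hE hD)
    · refine hE'.trans ?_
      rw [Finset.coe_union, Submodule.span_union, sup_assoc]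
      exact sup_le_sup_left ((vanishing_le t).trans (sup_le_sup_right hD' _)) _

/-- Vanishing to order `t` at a smooth point imposes at most `∑ s < t, multichoose n s` linear
conditions. -/
lemma finrank_le_finrank_inf_vanishing_add (V : Submodule K (Laurent K n)) [FiniteDimensional K V]
    (t : ℕ) :
    Module.finrank K V ≤ Module.finrank K (V ⊓ vanishing K n t : Submodule K (Laurent K n))
      + ∑ s ∈ Finset.range t, n.multichoose s := by
  classical
  obtain ⟨E, hE, hE'⟩ := exists_finset_span_sup_vanishing (K := K) (n := n) t
  let π := (vanishing K n t).mkQ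
  let φ : V →ₗ[K] (Laurent K n ⧸ vanishing K n t) := π.comp V.subtype
  have hspan : Submodule.span K ((E.image π : Finset _) : Set (Laurent K n ⧸ vanishing K n t))
      = ⊤ := by
    rw [Finset.coe_image, Submodule.span_image, eq_top_iff]
    rintro x -
    obtain ⟨f, rfl⟩ := Submodule.mkQ_surjective _ x
    obtain ⟨a, ha, b, hb, rfl⟩ := Submodule.mem_sup.1 (hE' (Submodule.mem_top (x := f)))
    refine ⟨a, ha, ?_⟩
    rw [map_add, show (vanishing K n t).mkQ b = 0 by simpa using hb, add_zero]
  have hfin : FiniteDimensional K (Laurent K n ⧸ vanishing K n t) := by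
    refine ⟨⟨E.image π, hspan⟩⟩
  have hq : Module.finrank K (Laurent K n ⧸ vanishing K n t)
      ≤ ∑ s ∈ Finset.range t, n.multichoose s := by
    rw [← finrank_top, ← hspan]
    exact (finrank_span_finset_le_card _).trans (Finset.card_image_le.trans hE)
  have hker : Module.finrank K (LinearMap.ker φ)
      ≤ Module.finrank K (V ⊓ vanishing K n t : Submodule K (Laurent K n)) := by
    have hfd : FiniteDimensional K (V ⊓ vanishing K n t : Submodule K (Laurent K n)) :=
      Submodule.finiteDimensional_inf_left _ _
    let ψ : LinearMap.ker φ →ₗ[K] (V ⊓ vanishing K n t : Submodule K (Laurent K n)) :=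
      LinearMap.codRestrict _ (V.subtype.comp (LinearMap.ker φ).subtype) (by
        rintro ⟨⟨f, hf⟩, hf'⟩
        refine ⟨hf, ?_⟩
        simpa [φ, π] using hf')
    refine LinearMap.finrank_le_finrank_of_injective (f := ψ) ?_
    rintro ⟨⟨f, hf⟩, hf'⟩ ⟨⟨g, hg⟩, hg'⟩ h
    simpa [ψ, Subtype.ext_iff] using h
  have h1 := LinearMap.finrank_range_add_finrank_ker φ
  have h2 := (Submodule.finrank_le (LinearMap.range φ)).trans hq
  lia

/-! ### Leading exponents -/

/-- `m` is the lexicographically largest exponent occurring in `f`. -/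
def IsLeadingExponent (f : Laurent K n) (m : Fin n → ℤ) : Prop :=
  f.coeff m ≠ 0 ∧ ∀ m', f.coeff m' ≠ 0 → toLex m' ≤ toLex m

lemma IsLeadingExponent.mul {f g : Laurent K n} {a b : Fin n → ℤ} (hf : IsLeadingExponent f a)
    (hg : IsLeadingExponent g b) : IsLeadingExponent (f * g) (a + b) := by
  classical
  refine ⟨?_, fun m hm => ?_⟩
  · rw [AddMonoidAlgebra.coeff_mul_add_of_uniqueAdd]
    · exact mul_ne_zero hf.1 hg.1
    · intro a' b' ha' hb' h
      have h1 := hf.2 a' (Finsupp.mem_support_iff.1 ha')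
      have h2 := hg.2 b' (Finsupp.mem_support_iff.1 hb')
      have h3 : toLex a' + toLex b' = toLex a + toLex b := congrArg toLex h
      exact ⟨toLex.injective (((add_eq_add_iff_eq_and_eq h1 h2).1 h3).1),
        toLex.injective (((add_eq_add_iff_eq_and_eq h1 h2).1 h3).2)⟩
  · have := AddMonoidAlgebra.support_coeff_mul_subset f g (Finsupp.mem_support_iff.2 hm)
    obtain ⟨a', ha', b', hb', rfl⟩ := Finset.mem_add.1 this
    exact add_le_add (hf.2 a' (Finsupp.mem_support_iff.1 ha'))
      (hg.2 b' (Finsupp.mem_support_iff.1 hb'))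

lemma isLeadingExponent_one : IsLeadingExponent (1 : Laurent K n) 0 := by
  classical
  refine ⟨by simp [AddMonoidAlgebra.one_def], fun m hm => ?_⟩
  have : m = 0 := by
    by_contra h
    exact hm (by simp [AddMonoidAlgebra.one_def, Ne.symm h])
  rw [this]

lemma IsLeadingExponent.prod {ι : Type*} (s : Finset ι) (f : ι → Laurent K n)
    (a : ι → Fin n → ℤ) (h : ∀ i ∈ s, IsLeadingExponent (f i) (a i)) :
    IsLeadingExponent (∏ i ∈ s, f i) (∑ i ∈ s, a i) := by
  classical
  induction s using Finset.induction_on with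
  | empty => simpa using isLeadingExponent_one
  | insert i s hi ih =>
    rw [Finset.prod_insert hi, Finset.sum_insert hi]
    exact (h i (by simp)).mul (ih fun j hj => h j (by simp [hj]))

lemma IsLeadingExponent.pow {f : Laurent K n} {a : Fin n → ℤ} (h : IsLeadingExponent f a)
    (c : ℕ) : IsLeadingExponent (f ^ c) (c • a) := by
  simpa using IsLeadingExponent.prod (Finset.range c) (fun _ => f) (fun _ => a) fun _ _ => h

lemma exists_isLeadingExponent {f : Laurent K n} (hf : f ≠ 0) : ∃ m, IsLeadingExponent f m := by
  have hs : f.coeff.support.Nonempty := by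
    rw [Finsupp.support_nonempty_iff]
    contrapose! hf
    ext m
    simp [hf]
  obtain ⟨m, hm, hmax⟩ := f.coeff.support.exists_max_image toLex hs
  exact ⟨m, Finsupp.mem_support_iff.1 hm, fun m' hm' => hmax m' (Finsupp.mem_support_iff.2 hm')⟩

/-- Laurent polynomials with exponents in `W`. -/
noncomputable def supportedIn (K : Type*) [Field K] {n : ℕ} (W : Finset (Fin n → ℤ)) :
    Submodule K (Laurent K n) :=
  (Finsupp.supported K K (W : Set (Fin n → ℤ))).comap
    (AddMonoidAlgebra.coeffLinearEquiv K).toLinearMap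

lemma mem_supportedIn {W : Finset (Fin n → ℤ)} {f : Laurent K n} :
    f ∈ supportedIn K W ↔ ∀ m, f.coeff m ≠ 0 → m ∈ W := by
  change f.coeff ∈ Finsupp.supported K K (W : Set (Fin n → ℤ)) ↔ _
  rw [Finsupp.mem_supported]
  simp [Set.subset_def]

/-- The equivalence between Laurent polynomials with exponents in `W` and coefficient vectors. -/
noncomputable def supportedInEquiv (K : Type*) [Field K] {n : ℕ} (W : Finset (Fin n → ℤ)) :
    supportedIn K W ≃ₗ[K] (W →₀ K) :=
  ((AddMonoidAlgebra.coeffLinearEquiv K).ofSubmodule' _).trans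
    (Finsupp.supportedEquivFinsupp (W : Set (Fin n → ℤ)))

instance (W : Finset (Fin n → ℤ)) : FiniteDimensional K (supportedIn K W) :=
  Module.Finite.equiv (supportedInEquiv K W).symm

lemma finrank_supportedIn (W : Finset (Fin n → ℤ)) :
    Module.finrank K (supportedIn K W) = W.card := by
  rw [(supportedInEquiv K W).finrank_eq]
  simp

open Classical in
/-- The exponents in `W` that are leading exponents of elements of `V`. -/
noncomputable def leadingExponents (V : Submodule K (Laurent K n)) (W : Finset (Fin n → ℤ)) :
    Finset (Fin n → ℤ) :=
  W.filter fun m => ∃ f ∈ V, IsLeadingExponent f m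

lemma finrank_le_card_leadingExponents {V : Submodule K (Laurent K n)} {W : Finset (Fin n → ℤ)}
    (hV : V ≤ supportedIn K W) :
    Module.finrank K V ≤ (leadingExponents V W).card := by
  classical
  let φ : V →ₗ[K] (leadingExponents V W → K) :=
    (LinearMap.pi fun m : leadingExponents V W => (Finsupp.lapply (m : Fin n → ℤ)).comp
      (AddMonoidAlgebra.coeffLinearEquiv K).toLinearMap).comp V.subtype
  have hφ : ∀ (f : V) m, φ f m = (f : Laurent K n).coeff m := fun f m => rfl
  have hinj : Function.Injective φ := by
    rw [← LinearMap.ker_eq_bot, LinearMap.ker_eq_bot']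
    intro f hf
    by_contra hne
    obtain ⟨m, hm⟩ := exists_isLeadingExponent (f := (f : Laurent K n)) (by simpa using hne)
    have hmem : m ∈ leadingExponents V W :=
      Finset.mem_filter.2 ⟨mem_supportedIn.1 (hV f.2) m hm.1, f, f.2, hm⟩
    exact hm.1 (by rw [← hφ f ⟨m, hmem⟩, hf]; rfl)
  simpa using LinearMap.finrank_le_finrank_of_injective hinj

/-! ### Reduction modulo `q` and the order of vanishing -/

/-- Reduction of the exponents of a Laurent polynomial modulo `q`; equivalently, the quotient map
by the ideal generated by the `xᵢ ^ q - 1`. -/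
noncomputable def reduceExponents (K : Type*) [Field K] (n q : ℕ) :
    Laurent K n →+* AddMonoidAlgebra K (Fin n → ZMod q) :=
  AddMonoidAlgebra.mapDomainRingHom K ((Int.castAddHom (ZMod q)).compLeft (Fin n))

/-- If the `q`-th powers of `#s` principal ideals vanish, so does the `#s * q`-th power of their
sum. -/
lemma iSup_span_singleton_pow_eq_bot {R ι : Type*} [CommRing R] {s : Finset ι}
    (hs : s.Nonempty) (y : ι → R) (q : ℕ) (h : ∀ i ∈ s, y i ^ q = 0) :
    (⨆ i ∈ s, Ideal.span {y i}) ^ (s.card * q) = (⊥ : Ideal R) := by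
  classical
  rw [← le_bot_iff]
  induction hs using Finset.Nonempty.cons_induction with
  | singleton i => simp [Ideal.span_singleton_pow, h i]
  | cons i s hi hs ih =>
    rw [Finset.cons_eq_insert, Finset.iSup_insert, Finset.card_insert_of_notMem hi, add_mul,
      one_mul, add_comm]
    refine Ideal.sup_pow_add_le_pow_sup_pow.trans (sup_le ?_ (ih fun j hj => h j (by simp [hj])))
    rw [Ideal.span_singleton_pow, h i (by simp)]
    simp

/-- In characteristic `p`, with `q = p ^ e`, the `q`-th powers `xᵢ ^ q - 1` of the generators of the
ideal of `(1, …, 1)` reduce to zero. -/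
lemma reduceExponents_eq_zero {p : ℕ} [Fact p.Prime] [CharP K p] (hn : 0 < n) (e : ℕ)
    {f : Laurent K n} (hf : f ∈ unitIdeal K n ^ (n * p ^ e)) :
    reduceExponents K n (p ^ e) f = 0 := by
  have hchar : CharP (AddMonoidAlgebra K (Fin n → ZMod (p ^ e))) p :=
    charP_of_injective_algebraMap (algebraMap K _).injective p
  set φ := reduceExponents K n (p ^ e) with hφ
  have hy : ∀ i ∈ Finset.univ, (φ (param K i)) ^ (p ^ e) = 0 := by
    intro i _
    rw [param, map_sub, map_one, sub_pow_char_pow, one_pow, hφ, reduceExponents,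
      AddMonoidAlgebra.mapDomainRingHom_apply, AddMonoidAlgebra.mapDomain_single,
      AddMonoidAlgebra.single_pow, one_pow, sub_eq_zero, AddMonoidAlgebra.one_def]
    congr 1
    ext j
    simp only [Pi.smul_apply, nsmul_eq_mul, Pi.zero_apply]
    rw [ZMod.natCast_self, zero_mul]
  have hmap : (unitIdeal K n).map φ = ⨆ i ∈ Finset.univ, Ideal.span {φ (param K i)} := by
    rw [unitIdeal, Ideal.map_span, ← Set.range_comp, ← Set.iUnion_singleton_eq_range,
      Ideal.span_iUnion]
    simp
  have h := iSup_span_singleton_pow_eq_bot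
    (Finset.univ_nonempty_iff.2 (Fin.pos_iff_nonempty.1 hn)) (fun i => φ (param K i)) (p ^ e) hy
  rw [← hmap, Finset.card_univ, Fintype.card_fin, ← Ideal.map_pow] at h
  have hmem := Ideal.mem_map_of_mem φ hf
  rwa [h] at hmem

/-- A linear form is at least `-a` on the Newton polytope of a product if it is at least `-a i` on
that of the `i`-th factor and `∑ a i = a`. -/
lemma neg_le_of_coeff_prod_ne_zero {ι : Type*} (l : (Fin n → ℤ) →+ ℤ) (s : Finset ι)
    (f : ι → Laurent K n) (a : ι → ℤ) (h : ∀ i ∈ s, ∀ m, (f i).coeff m ≠ 0 → -a i ≤ l m)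
    (m : Fin n → ℤ) (hm : (∏ i ∈ s, f i).coeff m ≠ 0) : -∑ i ∈ s, a i ≤ l m := by
  classical
  induction s using Finset.induction_on generalizing m with
  | empty =>
    have : m = 0 := by
      by_contra h
      exact hm (by simp [AddMonoidAlgebra.one_def, Ne.symm h])
    simp [this]
  | insert i s hi ih =>
    rw [Finset.prod_insert hi] at hm
    rw [Finset.sum_insert hi]
    obtain ⟨a', ha', b', hb', rfl⟩ := Finset.mem_add.1
      (AddMonoidAlgebra.support_coeff_mul_subset _ _ (Finsupp.mem_support_iff.2 hm))
    have h1 := h i (by simp) a' (Finsupp.mem_support_iff.1 ha')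
    have h2 := ih (fun j hj => h j (by simp [hj])) b' (Finsupp.mem_support_iff.1 hb')
    rw [map_add]
    lia

/-- If a single exponent of `f` lies in the class of `m` modulo `q`, then the coefficient at `m`
survives the reduction of exponents. -/
lemma reduceExponents_ne_zero {q : ℕ} {f : Laurent K n} {m : Fin n → ℤ} (hm : f.coeff m ≠ 0)
    (huniq : ∀ u : Fin n → ℤ, f.coeff (m + (q : ℤ) • u) ≠ 0 → u = 0) :
    reduceExponents K n q f ≠ 0 := by
  classical
  intro h0
  set g := (Int.castAddHom (ZMod q)).compLeft (Fin n) with hg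
  have h1 : (reduceExponents K n q f).coeff (g m) = f.coeff m := by
    rw [reduceExponents, AddMonoidAlgebra.mapDomainRingHom_apply, AddMonoidAlgebra.coeff_mapDomain,
      Finsupp.mapDomain, Finsupp.sum, Finsupp.finsetSum_apply, Finset.sum_eq_single m]
    · simp [hg]
    · intro m' hm' hne
      refine Finsupp.single_eq_of_ne ?_
      intro heq
      apply hne
      have hdvd : ∀ i, (q : ℤ) ∣ m' i - m i := by
        intro i
        rw [← ZMod.intCast_zmod_eq_zero_iff_dvd, Int.cast_sub, sub_eq_zero]
        exact congrFun heq.symm i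
      choose u hu using hdvd
      have hmu : m' = m + (q : ℤ) • u := by
        ext i
        simp [← hu i]
      have := huniq u (by rw [← hmu]; exact Finsupp.mem_support_iff.1 hm')
      simpa [this] using hmu
    · intro hm'
      simp [Finsupp.notMem_support_iff.1 hm']
  exact hm (by rw [← h1, h0]; rfl)

/-- A Laurent polynomial whose Newton polytope lies in `{l ≥ -M : l ∈ L}`, with leading exponent
`m` satisfying `l m + M ≤ B`, vanishes to order at most `n * B` at `(1, …, 1)`.
In characteristic `p`, high powers of the polynomial, whose order of vanishing is `n * q` or more,
lie in the ideal of the `xᵢ ^ q - 1`; but a multiple of `m` would be alone in its class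
modulo `q`. -/
lemma vanishing_order_le {p : ℕ} [Fact p.Prime] [CharP K p] (hn : 0 < n)
    {L : Set ((Fin n → ℤ) →+ ℤ)} (hL : ∀ u, (∀ l ∈ L, 0 ≤ l u) → u = 0)
    {f : Laurent K n} {m : Fin n → ℤ} (hm : IsLeadingExponent f m) {M B T : ℕ}
    (hB : 0 < B) (hf : ∀ l ∈ L, ∀ m', f.coeff m' ≠ 0 → -(M : ℤ) ≤ l m')
    (hmB : ∀ l ∈ L, l m + M ≤ B) (hT : f ∈ unitIdeal K n ^ T) : T ≤ n * B := by
  have key : ∀ e c : ℕ, c * B < p ^ e → c * T < n * p ^ e := by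
    intro e c hc
    by_contra! hle
    have hmem : f ^ c ∈ unitIdeal K n ^ (n * p ^ e) := by
      refine Ideal.pow_le_pow_right hle ?_
      rw [mul_comm, pow_mul]
      exact Ideal.pow_mem_pow hT c
    refine reduceExponents_ne_zero (q := p ^ e) (hm.pow c).1 (fun u hu => hL u fun l hl => ?_)
      (reduceExponents_eq_zero hn e hmem)
    have h1 := neg_le_of_coeff_prod_ne_zero l (Finset.range c) (fun _ => f) (fun _ => (M : ℤ))
      (fun _ _ => hf l hl) (c • m + ((p ^ e : ℕ) : ℤ) • u) (by simpa using hu)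
    simp only [Finset.sum_const, Finset.card_range, map_add, map_nsmul, map_zsmul, smul_eq_mul] at h1
    rw [nsmul_eq_mul, nsmul_eq_mul] at h1
    have h2 := hmB l hl
    have h3 : (c : ℤ) * l m + c * M ≤ c * B := by
      rw [← mul_add]; exact mul_le_mul_of_nonneg_left h2 (by positivity)
    have h4 : (c : ℤ) * B < (p ^ e : ℕ) := by exact_mod_cast hc
    by_contra! hneg
    have h5 : ((p ^ e : ℕ) : ℤ) * l u ≤ ((p ^ e : ℕ) : ℤ) * (-1) :=
      mul_le_mul_of_nonneg_left (by lia) (by positivity)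
    lia
  by_contra! hlt
  obtain ⟨e, he⟩ : ∃ e, n * B * B + B < p ^ e :=
    ⟨_, Nat.lt_pow_self (Fact.out : p.Prime).one_lt⟩
  -- the largest admissible exponent for this `q = p ^ e`
  set c := (p ^ e - 1) / B with hc
  have h1 : c * B ≤ p ^ e - 1 := Nat.div_mul_le_self _ _
  have h2 : p ^ e - 1 < (c + 1) * B := by
    rw [hc, mul_comm]; exact Nat.lt_mul_div_succ _ hB
  have h3 := key e c (by lia)
  have h4 : n * B ≤ c := by
    rw [hc, Nat.le_div_iff_mul_le hB]; lia
  have h5 : c * (n * B + 1) ≤ c * T := Nat.mul_le_mul_left _ hlt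
  have h6 : n * p ^ e ≤ n * ((c + 1) * B) := Nat.mul_le_mul_left _ (by lia)
  nlinarith

/-- For `m ∈ W`, the number of `t < T` such that `m` is the leading exponent of a polynomial
supported in `W` that vanishes to order `t + 1`; that is, the largest order (at most `T`)
of vanishing among the polynomials supported in `W` with leading exponent `m`. -/
noncomputable def jump (K : Type*) [Field K] {n : ℕ} (W : Finset (Fin n → ℤ)) (T : ℕ)
    (m : Fin n → ℤ) : ℕ :=
  open Classical in
  ((Finset.range T).filter fun t =>
    m ∈ leadingExponents (supportedIn K W ⊓ vanishing K n (t + 1)) W).card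

lemma leadingExponents_mono {V V' : Submodule K (Laurent K n)} (h : V ≤ V')
    (W : Finset (Fin n → ℤ)) : leadingExponents V W ⊆ leadingExponents V' W := by
  classical
  intro m hm
  obtain ⟨hmW, f, hf, hlead⟩ := Finset.mem_filter.1 hm
  exact Finset.mem_filter.2 ⟨hmW, f, h hf, hlead⟩

lemma vanishing_antitone : Antitone (vanishing K n) :=
  fun _ _ h _ hf => Ideal.pow_le_pow_right h hf

lemma exists_isLeadingExponent_mem_vanishing_jump (W : Finset (Fin n → ℤ)) (T : ℕ)
    {m : Fin n → ℤ} (hm : m ∈ W) :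
    ∃ f ∈ supportedIn K W, f ∈ unitIdeal K n ^ jump K W T m ∧ IsLeadingExponent f m := by
  classical
  obtain h0 | h0 := Nat.eq_zero_or_pos (jump K W T m)
  · refine ⟨single m 1, mem_supportedIn.2 fun m' hm' => ?_, by simp [h0], by simp, fun m' hm' => ?_⟩
    all_goals
      have : m' = m := by
        by_contra h
        exact hm' (by simp [Ne.symm h])
    · rwa [this]
    · rw [this]
  · by_cases hmem : m ∈ leadingExponents (supportedIn K W ⊓ vanishing K n (jump K W T m)) W
    · obtain ⟨-, f, hf, hlead⟩ := Finset.mem_filter.1 hmem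
      exact ⟨f, hf.1, hf.2, hlead⟩
    · -- the orders `t + 1` that occur for `m` form an initial segment
      exfalso
      have hsub : ((Finset.range T).filter fun t =>
          m ∈ leadingExponents (supportedIn K W ⊓ vanishing K n (t + 1)) W)
          ⊆ Finset.range (jump K W T m - 1) := by
        intro t ht
        by_contra hlt
        rw [Finset.mem_range, not_lt] at hlt
        exact hmem (leadingExponents_mono
          (inf_le_inf_left _ (vanishing_antitone (by lia))) W (Finset.mem_filter.1 ht).2)
      have := Finset.card_le_card hsub
      rw [Finset.card_range] at this
      change jump K W T m ≤ _ at this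
      lia

lemma mul_card_le_sum_jump_add (W : Finset (Fin n → ℤ)) (T : ℕ) :
    T * W.card ≤ ∑ m ∈ W, jump K W T m
      + ∑ t ∈ Finset.range T, ∑ s ∈ Finset.range (t + 1), n.multichoose s := by
  classical
  have h1 : ∑ m ∈ W, jump K W T m = ∑ t ∈ Finset.range T,
      (leadingExponents (supportedIn K W ⊓ vanishing K n (t + 1)) W).card := by
    simp only [jump, Finset.card_filter]
    rw [Finset.sum_comm]
    refine Finset.sum_congr rfl fun t _ => ?_
    rw [← Finset.card_filter, Finset.filter_mem_eq_inter, Finset.inter_eq_right.2]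
    exact Finset.filter_subset _ _
  rw [h1, ← Finset.sum_add_distrib]
  calc T * W.card = ∑ t ∈ Finset.range T, W.card := by simp
    _ ≤ _ := Finset.sum_le_sum fun t _ => ?_
  rw [← finrank_supportedIn (K := K) W]
  exact (finrank_le_finrank_inf_vanishing_add _ (t + 1)).trans
    (Nat.add_le_add_right (finrank_le_card_leadingExponents inf_le_left) _)

/-- The total order of vanishing at `(1, …, 1)` of a basis of the polynomials with exponents
in `W` is bounded below by counting conditions, and above by `vanishing_order_le` applied to the
product of the basis. -/
theorem mul_card_le (hn : 0 < n) {L : Set ((Fin n → ℤ) →+ ℤ)}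
    (hL : ∀ u, (∀ l ∈ L, 0 ≤ l u) → u = 0) (W : Finset (Fin n → ℤ)) {k B : ℕ}
    (hW : ∀ l ∈ L, ∀ m ∈ W, -(k : ℤ) ≤ l m) (hB : 0 < B)
    (hWB : ∀ l ∈ L, l (∑ m ∈ W, m) + W.card * k ≤ B) (T : ℕ) :
    T * W.card ≤ n * B + (T + n).choose (n + 1) := by
  classical
  have : Fact (Nat.Prime 2) := ⟨Nat.prime_two⟩
  let K := ZMod 2
  choose! f hf using fun m (hm : m ∈ W) =>
    exists_isLeadingExponent_mem_vanishing_jump (K := K) W T hm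
  have hlead : IsLeadingExponent (∏ m ∈ W, f m) (∑ m ∈ W, m) :=
    IsLeadingExponent.prod W f (fun m => m) fun m hm => (hf m hm).2.2
  have hvan : ∏ m ∈ W, f m ∈ unitIdeal K n ^ ∑ m ∈ W, jump K W T m := by
    rw [← Finset.prod_pow_eq_pow_sum]
    exact Ideal.prod_mem_prod fun m hm => (hf m hm).2.1
  have h1 : ∑ m ∈ W, jump K W T m ≤ n * B := by
    refine vanishing_order_le (p := 2) (M := W.card * k) hn hL hlead hB (fun l hl m hm => ?_)
      (fun l hl => by exact_mod_cast hWB l hl) hvan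
    have := neg_le_of_coeff_prod_ne_zero l W f (fun _ => (k : ℤ))
      (fun i hi m' hm' => hW l hl m' (mem_supportedIn.1 (hf i hi).1 m' hm')) m hm
    simpa using this
  have h2 := mul_card_le_sum_jump_add (K := K) W T
  have h3 : ∑ t ∈ Finset.range T, ∑ s ∈ Finset.range (t + 1), n.multichoose s
      = (T + n).choose (n + 1) := by
    simp only [Nat.sum_range_multichoose]
    cases T with
    | zero => simp
    | succ T => rw [Nat.sum_range_add_choose]; congr 1; ring
  lia

end Algebra

/-! ### Passage to the limit over lattice points -/

variable {n : ℕ}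

/-- The inclusion of `ℤⁿ` in `ℝⁿ`. -/
def toReal (m : Fin n → ℤ) : Fin n → ℝ := fun i => m i

/-- The integral linear form `⟨l, ·⟩` on `ℤⁿ`. -/
def dotHom (l : Fin n → ℤ) : (Fin n → ℤ) →+ ℤ where
  toFun m := l ⬝ᵥ m
  map_zero' := by simp
  map_add' := by simp

lemma cast_dotHom (l m : Fin n → ℤ) : ((dotHom l m : ℤ) : ℝ) = pairing l (toReal m) := by
  simp [dotHom, pairing, toReal, dotProduct]

lemma pairing_smul (l : Fin n → ℤ) (c : ℝ) (p : Fin n → ℝ) :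
    pairing l (c • p) = c * pairing l p := by
  simp only [pairing, Pi.smul_apply, smul_eq_mul, Finset.mul_sum]
  exact Finset.sum_congr rfl fun i _ => by ring

lemma finite_latticePoints {P : Set (Fin n → ℝ)} (hP : Bornology.IsBounded P) {k : ℕ}
    (hk : 0 < k) : {m : Fin n → ℤ | (k : ℝ)⁻¹ • toReal m ∈ P}.Finite := by
  obtain ⟨R, hR⟩ := hP.exists_norm_le
  have hk' : (0 : ℝ) < k := by exact_mod_cast hk
  refine (Set.finite_Icc (fun _ => -⌈R * k⌉) (fun _ => ⌈R * k⌉) : Set.Finite _).subset ?_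
  intro m hm
  have key : ∀ i, |(m i : ℝ)| ≤ R * k := by
    intro i
    have h1 := (norm_le_pi_norm _ i).trans (hR _ hm)
    rw [Pi.smul_apply, smul_eq_mul, norm_mul, norm_inv, Real.norm_natCast, toReal,
      Real.norm_eq_abs, inv_mul_le_iff₀ hk'] at h1
    linarith
  constructor
  · intro i
    have h1 := (abs_le.1 (key i)).1
    have h2 := Int.le_ceil (R * k)
    have : ((-⌈R * k⌉ : ℤ) : ℝ) ≤ m i := by push_cast; linarith
    exact_mod_cast this
  · intro i
    exact Int.cast_le.1 (((abs_le.1 (key i)).2).trans (Int.le_ceil _))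

open Classical in
/-- The lattice points of the dilate `k • P` (for bounded `P` and `k > 0`). -/
noncomputable def latticePoints (P : Set (Fin n → ℝ)) (k : ℕ) : Finset (Fin n → ℤ) :=
  if h : {m : Fin n → ℤ | (k : ℝ)⁻¹ • toReal m ∈ P}.Finite then h.toFinset else ∅

lemma mem_latticePoints {P : Set (Fin n → ℝ)} (hP : Bornology.IsBounded P) {k : ℕ}
    (hk : 0 < k) {m : Fin n → ℤ} : m ∈ latticePoints P k ↔ (k : ℝ)⁻¹ • toReal m ∈ P := by
  rw [latticePoints, dif_pos (finite_latticePoints hP hk)]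
  simp

open scoped Pointwise in
/-- Riemann sums over lattice points converge to the integral. -/
lemma tendsto_sum_latticePoints {P : Set (Fin n → ℝ)} (hconv : Convex ℝ P) (hcomp : IsCompact P)
    {F : (Fin n → ℝ) → ℝ} (hF : Continuous F) :
    Tendsto (fun k : ℕ => (∑ m ∈ latticePoints P k, F ((k : ℝ)⁻¹ • toReal m)) / (k : ℝ) ^ n)
      atTop (𝓝 (∫ x in P, F x)) := by
  classical
  have h := tendsto_tsum_div_pow_atTop_integral P F hF hcomp.isBounded hcomp.measurableSet
    (hconv.addHaar_frontier volume)
  rw [Fintype.card_fin] at h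
  refine h.congr' ?_
  filter_upwards [eventually_gt_atTop 0] with k hk
  congr 1
  have hk' : (k : ℝ) ≠ 0 := by exact_mod_cast hk.ne'
  have hset : P ∩ (k : ℝ)⁻¹ • (Submodule.span ℤ (Set.range (Pi.basisFun ℝ (Fin n))) :
      Set (Fin n → ℝ)) =
      ((latticePoints P k).image fun m => (k : ℝ)⁻¹ • toReal m : Finset (Fin n → ℝ)) := by
    ext x
    simp only [Set.mem_inter_iff, Finset.coe_image, Set.mem_image,
      mem_latticePoints hcomp.isBounded hk, Set.mem_smul_set, SetLike.mem_coe,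
      Module.Basis.mem_span_iff_repr_mem ℤ (Pi.basisFun ℝ (Fin n)), Pi.basisFun_repr]
    constructor
    · rintro ⟨hx, y, hy, rfl⟩
      choose m hm using hy
      have : y = toReal m := funext fun i => (hm i).symm
      exact ⟨m, this ▸ hx, by rw [this]⟩
    · rintro ⟨m, hm, rfl⟩
      exact ⟨hm, toReal m, fun i => ⟨m i, rfl⟩, rfl⟩
  rw [hset, Finset.tsum_subtype', Finset.sum_image]
  intro a _ b _ hab
  have := smul_right_injective (Fin n → ℝ) (inv_ne_zero hk') hab
  funext i
  exact Int.cast_injective (congrFun this i)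

lemma setIntegral_apply_eq_zero_of_barycenter {P : Set (Fin n → ℝ)} (hcomp : IsCompact P)
    (hpos : 0 < volume.real P) (hbar : barycenter P = 0) (i : Fin n) : ∫ x in P, x i = 0 := by
  rw [barycenter, setAverage_eq, smul_eq_zero] at hbar
  have h0 : ∫ x in P, x = 0 := hbar.resolve_left (inv_ne_zero hpos.ne')
  have hint : Integrable (fun x : Fin n → ℝ => x) (volume.restrict P) :=
    (continuous_id.continuousOn.integrableOn_compact hcomp)
  have := (ContinuousLinearMap.proj (R := ℝ) (φ := fun _ : Fin n => ℝ) i).integral_comp_comm hint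
  simpa [h0] using this

/-- If the barycenter is `0`, the sum of the `N` lattice points of `k • P` is `o(k N)`, so that it
lies in `-(ε k N) • P` for large `k`. -/
lemma eventually_neg_sum_latticePoints_mem {P : Set (Fin n → ℝ)} (hconv : Convex ℝ P)
    (hcomp : IsCompact P) (h0 : 0 ∈ interior P) (hpos : 0 < volume.real P)
    (hbar : barycenter P = 0) {ε : ℝ} (hε : 0 < ε) :
    ∀ᶠ k : ℕ in atTop, 0 < (latticePoints P k).card ∧
      (-(ε * k * (latticePoints P k).card)⁻¹) • toReal (∑ m ∈ latticePoints P k, m) ∈ P := by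
  have hcard : Tendsto (fun k : ℕ => ((latticePoints P k).card : ℝ) / (k : ℝ) ^ n) atTop
      (𝓝 (volume.real P)) := by
    simpa using tendsto_sum_latticePoints hconv hcomp (F := fun _ => 1) continuous_const
  have hsum : ∀ i, Tendsto (fun k : ℕ =>
      (∑ m ∈ latticePoints P k, (k : ℝ)⁻¹ * (m i : ℝ)) / (k : ℝ) ^ n) atTop (𝓝 0) := by
    intro i
    rw [← setIntegral_apply_eq_zero_of_barycenter hcomp hpos hbar i]
    exact tendsto_sum_latticePoints hconv hcomp (F := fun x => x i) (continuous_apply i)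
  have hevcard : ∀ᶠ k : ℕ in atTop, 0 < (latticePoints P k).card := by
    filter_upwards [hcard.eventually (lt_mem_nhds hpos)] with k hk
    by_contra! hle
    rw [Nat.le_zero.1 hle] at hk
    simp at hk
  have hlim : Tendsto (fun k : ℕ => (-(ε * k * (latticePoints P k).card)⁻¹) •
      toReal (∑ m ∈ latticePoints P k, m)) atTop (𝓝 0) := by
    rw [tendsto_pi_nhds]
    intro i
    have h1 := ((hsum i).div hcard hpos.ne').const_mul (-ε⁻¹)
    rw [zero_div, mul_zero] at h1
    refine h1.congr' ?_
    filter_upwards [hevcard, eventually_gt_atTop 0] with k hk hk0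
    have hk1 : (0 : ℝ) < (latticePoints P k).card := by exact_mod_cast hk
    have hk2 : (0 : ℝ) < k := by exact_mod_cast hk0
    simp only [Pi.div_apply, Pi.smul_apply, smul_eq_mul, toReal, Finset.sum_apply, Int.cast_sum,
      ← Finset.mul_sum]
    field_simp
  exact hevcard.and (hlim.eventually (mem_interior_iff_mem_nhds.1 h0))

/-- The volume bound for a convex body with barycenter `0` inside the polyhedron `{l ≥ -1 : l ∈ L}`,
where `L` is a set of integral forms that are not all nonnegative at any nonzero lattice point. -/
theorem volumeBound_of_forms (hn : 0 < n) {P : Set (Fin n → ℝ)} (hconv : Convex ℝ P)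
    (hcomp : IsCompact P) (h0 : 0 ∈ interior P) (hbar : barycenter P = 0) (L : Set (Fin n → ℤ))
    (hLP : ∀ l ∈ L, ∀ p ∈ P, -1 ≤ pairing l p)
    (hL : ∀ u : Fin n → ℤ, (∀ l ∈ L, 0 ≤ pairing l (toReal u)) → u = 0) : VolumeBound P := by
  have hfin : volume P ≠ ⊤ := hcomp.measure_lt_top.ne
  have hpos : 0 < volume.real P :=
    ENNReal.toReal_pos (Measure.measure_pos_of_mem_nhds _ (mem_interior_iff_mem_nhds.1 h0)).ne' hfin
  have hcard : Tendsto (fun k : ℕ => ((latticePoints P k).card : ℝ) / (k : ℝ) ^ n) atTop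
      (𝓝 (volume.real P)) := by
    simpa using tendsto_sum_latticePoints hconv hcomp (F := fun _ => 1) continuous_const
  have hinv : Tendsto (fun k : ℕ => ((k : ℝ))⁻¹) atTop (𝓝 0) :=
    tendsto_inv_atTop_zero.comp tendsto_natCast_atTop_atTop
  have key : ∀ ε : ℝ, 0 < ε → (n + 1) * volume.real P ≤ n * ((1 + ε) * volume.real P)
      + (n + 1 : ℝ) ^ (n + 1) / (n + 1).factorial := by
    intro ε hε
    have hright : Tendsto (fun k : ℕ => n * ((1 + ε) * (((latticePoints P k).card : ℝ) / (k : ℝ) ^ n)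
        + ((k : ℝ)⁻¹) ^ (n + 1)) + ((n + 1) + n * (k : ℝ)⁻¹) ^ (n + 1) / (n + 1).factorial) atTop
        (𝓝 (n * ((1 + ε) * volume.real P + 0 ^ (n + 1))
          + ((n + 1) + n * 0 : ℝ) ^ (n + 1) / (n + 1).factorial)) :=
      ((((hcard.const_mul _).add (hinv.pow _)).const_mul _).add
        ((((hinv.const_mul _).const_add _).pow _).div_const _))
    have hright' : n * ((1 + ε) * volume.real P + 0 ^ (n + 1))
          + ((n + 1) + n * 0 : ℝ) ^ (n + 1) / (n + 1).factorial
        = n * ((1 + ε) * volume.real P) + (n + 1 : ℝ) ^ (n + 1) / (n + 1).factorial := by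
      simp
    rw [hright'] at hright
    refine le_of_tendsto_of_tendsto (hcard.const_mul _) hright ?_
    filter_upwards [eventually_neg_sum_latticePoints_mem hconv hcomp h0 hpos hbar hε,
      eventually_gt_atTop 0] with k ⟨hWpos, hmem⟩ hk
    set W := latticePoints P k with hW
    have hk' : (0 : ℝ) < k := by exact_mod_cast hk
    have hN' : (0 : ℝ) < W.card := by exact_mod_cast hWpos
    have hc : 0 < ε * k * W.card := by positivity
    -- the membership `hmem` bounds the forms in `L` by `ε * k * #W` on the sum of `W`
    have hmain := mul_card_le hn (L := dotHom '' L) (k := k)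
      (B := ⌈ε * k * W.card⌉₊ + W.card * k)
      (fun u hu => hL u fun l hl => by
        rw [← cast_dotHom]; exact_mod_cast hu _ ⟨l, hl, rfl⟩) W
      (by
        rintro _ ⟨l, hl, rfl⟩ m hm
        have h1 := hLP l hl _ ((mem_latticePoints hcomp.isBounded hk).1 hm)
        rw [pairing_smul, ← cast_dotHom, le_inv_mul_iff₀ hk'] at h1
        have h2 : (-(k : ℤ) : ℝ) ≤ dotHom l m := by push_cast; linarith
        exact_mod_cast h2)
      (by positivity)
      (by
        rintro _ ⟨l, hl, rfl⟩
        have h1 := hLP l hl _ hmem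
        rw [pairing_smul, ← cast_dotHom, neg_mul, neg_le_neg_iff, inv_mul_le_iff₀ hc, mul_one] at h1
        have h2 : ((dotHom l (∑ m ∈ W, m) : ℤ) : ℝ) ≤ ((⌈ε * k * W.card⌉₊ : ℤ) : ℝ) := by
          push_cast
          exact h1.trans (Nat.le_ceil _)
        have h3 := Int.cast_le.1 h2
        push_cast
        linarith)
      ((n + 1) * k)
    have hceil := (Nat.ceil_lt_add_one hc.le).le
    have hch : (((n + 1) * k + n).choose (n + 1) : ℝ)
        ≤ (((n + 1) * k + n : ℕ) : ℝ) ^ (n + 1) / (n + 1).factorial :=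
      Nat.choose_le_pow_div (α := ℝ) (n + 1) ((n + 1) * k + n)
    have hmain' : (((n + 1) * k * W.card : ℕ) : ℝ) ≤ ((n * (⌈ε * k * W.card⌉₊ + W.card * k)
        + ((n + 1) * k + n).choose (n + 1) : ℕ) : ℝ) := by exact_mod_cast hmain
    push_cast at hmain' hch
    have hfinal : ((n : ℝ) + 1) * k * W.card ≤ n * ((ε * k * W.card + 1) + W.card * k)
        + (((n : ℝ) + 1) * k + n) ^ (n + 1) / (n + 1).factorial := by
      refine hmain'.trans (add_le_add ?_ hch)
      gcongr
    have hkpow : (0 : ℝ) < (k : ℝ) ^ (n + 1) := by positivity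
    have e1 : ((n : ℝ) + 1) * (W.card / (k : ℝ) ^ n)
        = (((n : ℝ) + 1) * k * W.card) / (k : ℝ) ^ (n + 1) := by
      rw [pow_succ]; field_simp
    have e2 : (n : ℝ) * ((1 + ε) * (W.card / (k : ℝ) ^ n) + ((k : ℝ)⁻¹) ^ (n + 1))
        + ((n + 1) + n * (k : ℝ)⁻¹) ^ (n + 1) / (n + 1).factorial
        = (n * ((ε * k * W.card + 1) + W.card * k)
        + (((n : ℝ) + 1) * k + n) ^ (n + 1) / (n + 1).factorial) / (k : ℝ) ^ (n + 1) := by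
      have : ((n : ℝ) + 1) * k + n = ((n + 1) + n * (k : ℝ)⁻¹) * k := by field_simp
      rw [this, mul_pow, inv_pow, pow_succ (k : ℝ) n]
      field_simp
      ring
    rw [e1, e2]
    gcongr
  have hV : volume.real P ≤ ((n : ℝ) + 1) ^ n / n.factorial := by
    have hC : (n + 1 : ℝ) ^ (n + 1) / (n + 1).factorial = ((n : ℝ) + 1) ^ n / n.factorial := by
      rw [Nat.factorial_succ, pow_succ]
      push_cast
      field_simp
    have hn' : (0 : ℝ) < n := by exact_mod_cast hn
    refine le_of_forall_pos_le_add fun δ hδ => ?_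
    have h1 := key (δ / (n * volume.real P)) (by positivity)
    have h2 : n * ((1 + δ / (n * volume.real P)) * volume.real P) = n * volume.real P + δ := by
      field_simp
    rw [h2, hC] at h1
    linarith
  rw [VolumeBound, ← ofReal_measureReal hfin]
  exact ENNReal.ofReal_le_ofReal hV

/-! ### Polars of lattice polytopes -/

lemma mem_dual_iff {Q : Set (Fin n → ℝ)} {p : Fin n → ℝ} :
    p ∈ dual Q ↔ ∀ q ∈ Q, -1 ≤ q ⬝ᵥ p := Iff.rfl

lemma convex_dual (Q : Set (Fin n → ℝ)) : Convex ℝ (dual Q) := by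
  intro x hx y hy a b ha hb hab q hq
  have h1 := mem_dual_iff.1 hx q hq
  have h2 := mem_dual_iff.1 hy q hq
  change -1 ≤ q ⬝ᵥ (a • x + b • y)
  rw [dotProduct_add, dotProduct_smul, dotProduct_smul, smul_eq_mul, smul_eq_mul]
  nlinarith

lemma isClosed_dual (Q : Set (Fin n → ℝ)) : IsClosed (dual Q) := by
  have : dual Q = ⋂ q ∈ Q, {p | -1 ≤ ∑ i, q i * p i} := by ext; simp [dual]
  rw [this]
  exact isClosed_biInter fun q _ => isClosed_le continuous_const (by fun_prop)

lemma isBounded_dual {Q : Set (Fin n → ℝ)} (h0 : 0 ∈ interior Q) :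
    Bornology.IsBounded (dual Q) := by
  obtain ⟨r, hr, hball⟩ := Metric.mem_nhds_iff.1 (mem_interior_iff_mem_nhds.1 h0)
  have hmem : ∀ (i : Fin n) (c : ℝ), |c| < r → Pi.single i c ∈ Q := by
    intro i c hc
    apply hball
    rw [mem_ball_zero_iff, Pi.norm_single]
    exact hc
  refine isBounded_iff_forall_norm_le.2 ⟨2 / r, fun p hp => ?_⟩
  refine (pi_norm_le_iff_of_nonneg (by positivity)).2 fun i => ?_
  have habs : |r / 2| < r := by rw [abs_of_pos (by positivity)]; linarith
  have h1 := mem_dual_iff.1 hp _ (hmem i (r / 2) habs)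
  have h2 := mem_dual_iff.1 hp _ (hmem i (-(r / 2)) (by rwa [abs_neg]))
  rw [single_dotProduct] at h1 h2
  rw [Real.norm_eq_abs, abs_le, ← neg_div, div_le_iff₀ hr, le_div_iff₀ hr]
  constructor <;> linarith

lemma zero_mem_interior_dual {Q : Set (Fin n → ℝ)} (hQ : Bornology.IsBounded Q) :
    0 ∈ interior (dual Q) := by
  obtain ⟨R, hRpos, hR⟩ := hQ.exists_pos_norm_le
  rw [mem_interior_iff_mem_nhds]
  refine Metric.mem_nhds_iff.2 ⟨1 / (n * R + 1), by positivity, fun p hp => ?_⟩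
  rw [mem_ball_zero_iff, lt_div_iff₀ (by positivity)] at hp
  refine mem_dual_iff.2 fun q hq => neg_le_of_abs_le ?_
  calc |q ⬝ᵥ p| ≤ ∑ i : Fin n, |q i * p i| := Finset.abs_sum_le_sum_abs _ _
    _ ≤ ∑ i : Fin n, R * ‖p‖ := by
        refine Finset.sum_le_sum fun i _ => ?_
        rw [abs_mul]
        exact mul_le_mul ((norm_le_pi_norm q i).trans (hR q hq)) (norm_le_pi_norm p i)
          (abs_nonneg _) hRpos.le
    _ = n * R * ‖p‖ := by simp [mul_assoc]
    _ ≤ 1 := by nlinarith [norm_nonneg p]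

lemma convex_setOf_le_dotProduct (p : Fin n → ℝ) (c : ℝ) :
    Convex ℝ {q : Fin n → ℝ | c ≤ q ⬝ᵥ p} := by
  intro x hx y hy a b ha hb hab
  change c ≤ (a • x + b • y) ⬝ᵥ p
  change c ≤ x ⬝ᵥ p at hx
  change c ≤ y ⬝ᵥ p at hy
  rw [add_dotProduct, smul_dotProduct, smul_dotProduct, smul_eq_mul, smul_eq_mul]
  calc c = a * c + b * c := by rw [← add_mul, hab, one_mul]
    _ ≤ _ := by gcongr

lemma le_dotProduct_of_mem_convexHull {S : Set (Fin n → ℝ)} {p q : Fin n → ℝ} {c : ℝ}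
    (h : ∀ s ∈ S, c ≤ s ⬝ᵥ p) (hq : q ∈ convexHull ℝ S) : c ≤ q ⬝ᵥ p :=
  convexHull_min h (convex_setOf_le_dotProduct p c) hq

lemma exists_pos_neg_smul_mem {Q : Set (Fin n → ℝ)} (h0 : 0 ∈ interior Q) (v : Fin n → ℝ) :
    ∃ δ : ℝ, 0 < δ ∧ -(δ • v) ∈ Q := by
  have hlim : Filter.Tendsto (fun δ : ℝ => -(δ • v)) (nhdsWithin 0 (Set.Ioi 0)) (nhds 0) := by
    have : Filter.Tendsto (fun δ : ℝ => -(δ • v)) (nhds 0) (nhds (-((0 : ℝ) • v))) :=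
      Continuous.tendsto (by fun_prop) 0
    rw [zero_smul, neg_zero] at this
    exact this.mono_left nhdsWithin_le_nhds
  obtain ⟨δ, hδ, hδ0⟩ := ((hlim.eventually (mem_interior_iff_mem_nhds.1 h0)).and
    self_mem_nhdsWithin).exists
  exact ⟨δ, hδ0, hδ⟩

/-- If `0` is interior to the convex hull of `S`, then no nonzero vector pairs nonnegatively with
all of `S`. -/
lemma eq_zero_of_dotProduct_nonneg {S : Set (Fin n → ℝ)} (h0 : 0 ∈ interior (convexHull ℝ S))
    {v : Fin n → ℝ} (hv : ∀ s ∈ S, 0 ≤ s ⬝ᵥ v) : v = 0 := by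
  obtain ⟨δ, hδ, hmem⟩ := exists_pos_neg_smul_mem h0 v
  have h := le_dotProduct_of_mem_convexHull hv hmem
  rw [neg_dotProduct, smul_dotProduct, smul_eq_mul] at h
  have h1 : v ⬝ᵥ v ≤ 0 := by nlinarith
  exact dotProduct_self_eq_zero.1 (le_antisymm h1 (Finset.sum_nonneg fun i _ => mul_self_nonneg _))

lemma toReal_injective : Function.Injective (toReal (n := n)) :=
  fun _ _ h => funext fun i => Int.cast_injective (congrFun h i)

lemma toReal_zero : toReal (0 : Fin n → ℤ) = 0 := by ext; simp [toReal]

/-- The volume bound for a convex body inside the polar of a convex set that is spanned by lattice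
points and contains `0` in its interior. -/
lemma volumeBound_of_subset_dual (hn : 0 < n) {P : Set (Fin n → ℝ)} (hconv : Convex ℝ P)
    (hcomp : IsCompact P) (h0 : 0 ∈ interior P) (hbar : barycenter P = 0) {S : Set (Fin n → ℤ)}
    (hS : 0 ∈ interior (convexHull ℝ (toReal '' S)))
    (hP : P ⊆ dual (convexHull ℝ (toReal '' S))) : VolumeBound P := by
  refine volumeBound_of_forms hn hconv hcomp h0 hbar S (fun l hl p hp => ?_) fun u hu => ?_
  · exact hP hp _ (subset_convexHull ℝ _ ⟨l, hl, rfl⟩)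
  · refine toReal_injective ((eq_zero_of_dotProduct_nonneg hS ?_).trans toReal_zero.symm)
    rintro _ ⟨l, hl, rfl⟩
    exact hu l hl

/-- In dimension zero the volume of a set is at most `1`. -/
lemma volumeBound_zero (P : Set (Fin 0 → ℝ)) : VolumeBound P := by
  refine (measure_mono (Set.subset_univ P)).trans ?_
  rw [volume_pi, Measure.pi_univ]
  simp

lemma VolumeBound.of_volume_eq_zero {P : Set (Fin n → ℝ)} (h : volume P = 0) : VolumeBound P := by
  rw [VolumeBound, h]; exact zero_le

lemma isCompact_of_isLatticePolytope {P : Set (Fin n → ℝ)} (hP : IsLatticePolytope P) :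
    IsCompact P := by
  obtain ⟨S, rfl⟩ := hP
  exact (S.finite_toSet.image _).isCompact_convexHull ℝ

lemma convex_of_isLatticePolytope {P : Set (Fin n → ℝ)} (hP : IsLatticePolytope P) :
    Convex ℝ P := by
  obtain ⟨S, rfl⟩ := hP
  exact convex_convexHull ℝ _

/-- A continuous linear functional on `ℝⁿ` is the pairing with a vector. -/
lemma exists_eq_dotProduct (f : (Fin n → ℝ) →ₗ[ℝ] ℝ) : ∃ z : Fin n → ℝ, ∀ x, f x = z ⬝ᵥ x := by
  refine ⟨fun i => f (Pi.single i 1), fun x => ?_⟩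
  rw [LinearMap.pi_apply_eq_sum_univ f x]
  refine Finset.sum_congr rfl fun i _ => ?_
  rw [smul_eq_mul, mul_comm]
  congr 2
  ext j
  simp [Pi.single_apply, eq_comm]

/-- A convex body whose polar is bounded contains `0` in its interior. -/
lemma zero_mem_interior_of_isBounded_dual {P : Set (Fin n → ℝ)} (hconv : Convex ℝ P)
    (hint : (interior P).Nonempty) (hdual : Bornology.IsBounded (dual P)) : 0 ∈ interior P := by
  by_contra h0
  obtain ⟨f, hf⟩ := geometric_hahn_banach_open_point hconv.interior isOpen_interior h0
  obtain ⟨z, hz⟩ := exists_eq_dotProduct (f : (Fin n → ℝ) →ₗ[ℝ] ℝ)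
  replace hz : ∀ x, f x = z ⬝ᵥ x := hz
  simp only [map_zero] at hf
  have hle : ∀ p ∈ P, f p ≤ 0 := by
    intro p hp
    have hp' : p ∈ closure (interior P) := by
      rw [hconv.closure_interior_eq_closure_of_nonempty_interior hint]
      exact subset_closure hp
    exact closure_minimal (fun a ha => (hf a ha).le) (isClosed_le f.continuous continuous_const) hp'
  -- the ray spanned by `-z` lies in the polar
  have hray : ∀ t : ℝ, 0 ≤ t → -(t • z) ∈ dual P := by
    intro t ht
    refine mem_dual_iff.2 fun p hp => ?_
    have := hle p hp
    rw [hz] at this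
    rw [dotProduct_neg, dotProduct_smul, smul_eq_mul, dotProduct_comm]
    nlinarith
  obtain ⟨R, hR⟩ := hdual.exists_norm_le
  have hz0 : z = 0 := by
    by_contra hne
    have hpos : 0 < ‖z‖ := norm_pos_iff.2 hne
    have h1 := hR _ (hray ((|R| + 1) / ‖z‖) (by positivity))
    rw [norm_neg, norm_smul, Real.norm_of_nonneg (by positivity), div_mul_cancel₀ _ hpos.ne'] at h1
    linarith [le_abs_self R]
  obtain ⟨a, ha⟩ := hint
  have := hf a ha
  rw [hz, hz0, zero_dotProduct] at this
  exact lt_irrefl _ this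

theorem volumeBound_dual {Q : Set (Fin n → ℝ)} (hQ : IsLatticePolytope Q) (h0 : 0 ∈ interior Q)
    (hbar : barycenter (dual Q) = 0) : VolumeBound (dual Q) := by
  obtain rfl | hn := Nat.eq_zero_or_pos n
  · exact volumeBound_zero _
  have hcomp : IsCompact (dual Q) :=
    Metric.isCompact_of_isClosed_isBounded (isClosed_dual Q) (isBounded_dual h0)
  have hint := zero_mem_interior_dual (isCompact_of_isLatticePolytope hQ).isBounded
  obtain ⟨S, rfl⟩ := hQ
  exact volumeBound_of_subset_dual hn (convex_dual _) hcomp hint hbar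
    (S := (S : Set (Fin n → ℤ))) h0 subset_rfl

theorem volumeBound_of_isReflexive {P : Set (Fin n → ℝ)} (hP : IsReflexive P)
    (hbar : barycenter P = 0) : VolumeBound P := by
  obtain rfl | hn := Nat.eq_zero_or_pos n
  · exact volumeBound_zero _
  have hconv := convex_of_isLatticePolytope hP.lattice
  have hcomp := isCompact_of_isLatticePolytope hP.lattice
  obtain hempty | hint := (interior P).eq_empty_or_nonempty
  · refine VolumeBound.of_volume_eq_zero (measure_mono_null ?_ (hconv.addHaar_frontier volume))
    rw [frontier, hempty, Set.sdiff_empty]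
    exact subset_closure
  have h0 := zero_mem_interior_of_isBounded_dual hconv hint
    (isCompact_of_isLatticePolytope hP.dual_lattice).isBounded
  have hd0 := zero_mem_interior_dual hcomp.isBounded
  obtain ⟨S, hS⟩ := hP.dual_lattice
  rw [hS] at hd0
  refine volumeBound_of_subset_dual hn hconv hcomp h0 hbar (S := (S : Set (Fin n → ℤ))) hd0 ?_
  intro p hp
  refine mem_dual_iff.2 fun q hq => ?_
  replace hq : q ∈ dual P := by rw [hS]; exact hq
  rw [dotProduct_comm]
  exact hq p hp

/-! ### Facets of rational polytopes -/

/-- The inclusion of `ℚⁿ` in `ℝⁿ`. -/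
def ratToReal (v : Fin n → ℚ) : Fin n → ℝ := fun i => v i

/-- A real vector `y` whose pairings with a set `A` of rational points are rational is itself
rational, if no nonzero vector is orthogonal to `A`. -/
lemma exists_eq_ratToReal {A : Set (Fin n → ℚ)}
    (hA : ∀ z : Fin n → ℝ, (∀ s ∈ A, z ⬝ᵥ ratToReal s = 0) → z = 0) {y : Fin n → ℝ}
    (hy : ∀ s ∈ A, ∃ c : ℚ, y ⬝ᵥ ratToReal s = c) : ∃ y' : Fin n → ℚ, y = ratToReal y' := by
  let H : Submodule ℚ (Fin n → ℚ) :=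
    { carrier := {x | ∃ c : ℚ, y ⬝ᵥ ratToReal x = c}
      zero_mem' := ⟨0, by simp [ratToReal, dotProduct]⟩
      add_mem' := by
        rintro a b ⟨c, hc⟩ ⟨d, hd⟩
        refine ⟨c + d, ?_⟩
        rw [Rat.cast_add, ← hc, ← hd, ← dotProduct_add]
        congr 1
        ext i
        simp [ratToReal]
      smul_mem' := by
        rintro r a ⟨c, hc⟩
        refine ⟨r * c, ?_⟩
        rw [Rat.cast_mul, ← hc, ← smul_eq_mul, ← dotProduct_smul]
        congr 1
        ext i
        simp [ratToReal] }
  have hAH : ∀ s ∈ A, s ∈ H := hy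
  have hH : H = ⊤ := by
    by_contra hne
    -- a rational functional vanishing on `A` is given by a vector orthogonal to `A`
    obtain ⟨f, hf0, hf⟩ := H.exists_le_ker_of_lt_top (lt_top_iff_ne_top.2 hne)
    have hz : ratToReal (fun i => f (Pi.single i 1)) = 0 := by
      refine hA _ fun s hs => ?_
      have h1 : f s = 0 := hf (hAH s hs)
      rw [LinearMap.pi_apply_eq_sum_univ f s] at h1
      have h2 : ((∑ i, s i • f (fun j => if i = j then 1 else 0) : ℚ) : ℝ) = 0 := by
        rw [h1, Rat.cast_zero]
      rw [← h2, Rat.cast_sum]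
      refine Finset.sum_congr rfl fun i _ => ?_
      have hi : (fun j => if i = j then (1 : ℚ) else 0) = Pi.single i 1 := by
        ext j
        simp [Pi.single_apply, eq_comm]
      rw [hi, smul_eq_mul, Rat.cast_mul, mul_comm]
      rfl
    apply hf0
    refine LinearMap.pi_ext' fun i => LinearMap.ext_ring ?_
    have h3 : ((f (Pi.single i 1) : ℚ) : ℝ) = 0 := congrFun hz i
    simpa using h3
  have hall : ∀ i, ∃ c : ℚ, y i = c := by
    intro i
    obtain ⟨c, hc⟩ := (hH ▸ Submodule.mem_top : (Pi.single i 1 : Fin n → ℚ) ∈ H)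
    refine ⟨c, ?_⟩
    rw [← hc]
    have : ratToReal (Pi.single i 1 : Fin n → ℚ) = Pi.single i 1 := by
      ext j
      by_cases h : j = i
      · subst h; simp [ratToReal]
      · simp [ratToReal, h]
    rw [this, dotProduct_single, mul_one]
  choose y' hy' using hall
  exact ⟨y', funext hy'⟩

/-- Every nonzero rational vector is a positive rational multiple of a primitive lattice vector. -/
lemma exists_isPrimitive_smul {y : Fin n → ℚ} (hy : y ≠ 0) :
    ∃ (l : Fin n → ℤ) (a : ℚ), 0 < a ∧ IsPrimitive l ∧ ∀ i, (l i : ℚ) = a * y i := by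
  classical
  set d : ℕ := ∏ i, (y i).den with hd
  have hdpos : 0 < d := Finset.prod_pos fun i _ => (y i).den_pos
  have hint : ∀ i, ∃ m : ℤ, (m : ℚ) = d * y i := by
    intro i
    obtain ⟨c, hc⟩ : (y i).den ∣ d := Finset.dvd_prod_of_mem (fun i => (y i).den) (Finset.mem_univ i)
    refine ⟨c * (y i).num, ?_⟩
    rw [hc]
    push_cast
    rw [mul_comm ((y i).den : ℚ), mul_assoc, Rat.den_mul_eq_num]
  choose m hm using hint
  obtain ⟨i₀, hi₀⟩ := Function.ne_iff.1 hy
  have hne : (Finset.univ : Finset (Fin n)).Nonempty := ⟨i₀, Finset.mem_univ _⟩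
  obtain ⟨l, hl, hl1⟩ := Finset.extract_gcd m hne
  set g := Finset.univ.gcd m with hg
  have hd' : (d : ℚ) ≠ 0 := by exact_mod_cast hdpos.ne'
  have hg0 : g ≠ 0 := by
    intro h
    have h1 := hl i₀ (Finset.mem_univ _)
    rw [h, zero_mul] at h1
    have h2 := hm i₀
    rw [h1, Int.cast_zero] at h2
    exact mul_ne_zero hd' hi₀ h2.symm
  have hgnn : 0 ≤ g := by
    have : normalize g = g := Finset.normalize_gcd
    rw [← this]
    exact Int.nonneg_of_normalize_eq_self (by simp)
  have hgpos : (0 : ℚ) < g := by exact_mod_cast lt_of_le_of_ne hgnn (Ne.symm hg0)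
  refine ⟨l, d / g, by positivity, hl1, fun i => ?_⟩
  have h1 := hm i
  rw [hl i (Finset.mem_univ _), Int.cast_mul] at h1
  field_simp
  linarith

/-- At an extreme point of the polar of a finite set, no nonzero vector is orthogonal to all the
active constraints. -/
lemma eq_zero_of_mem_extremePoints_dual {S : Set (Fin n → ℝ)} (hS : S.Finite) {y : Fin n → ℝ}
    (hy : y ∈ (dual S).extremePoints ℝ) {z : Fin n → ℝ}
    (hz : ∀ s ∈ S, s ⬝ᵥ y = -1 → s ⬝ᵥ z = 0) : z = 0 := by
  have hyD := hy.1
  have hev : ∀ w : Fin n → ℝ, (∀ s ∈ S, s ⬝ᵥ y = -1 → s ⬝ᵥ w = 0) →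
      ∀ᶠ ε : ℝ in nhdsWithin 0 (Set.Ioi 0), y + ε • w ∈ dual S := by
    intro w hw
    have : ∀ s ∈ S, ∀ᶠ ε : ℝ in nhdsWithin 0 (Set.Ioi 0), -1 ≤ s ⬝ᵥ (y + ε • w) := by
      intro s hs
      by_cases hact : s ⬝ᵥ y = -1
      · refine Filter.Eventually.of_forall fun ε => ?_
        rw [dotProduct_add, dotProduct_smul, hw s hs hact, hact]
        simp
      · have hlt : -1 < s ⬝ᵥ y := lt_of_le_of_ne (mem_dual_iff.1 hyD s hs) (Ne.symm hact)
        have hlim : Filter.Tendsto (fun ε : ℝ => s ⬝ᵥ (y + ε • w)) (nhds 0) (nhds (s ⬝ᵥ y)) := by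
          have hc : Continuous fun ε : ℝ => s ⬝ᵥ (y + ε • w) := by
            simp only [dotProduct_add, dotProduct_smul]
            fun_prop
          simpa using hc.tendsto 0
        exact ((hlim.eventually (lt_mem_nhds hlt)).filter_mono nhdsWithin_le_nhds).mono
          fun _ h => h.le
    exact (Filter.eventually_all_finite hS).2 this
  obtain ⟨ε, ⟨h1, h2⟩, hε⟩ := (((hev z hz).and
    (hev (-z) fun s hs h => by rw [dotProduct_neg, hz s hs h, neg_zero])).and
    self_mem_nhdsWithin).exists
  have hseg : y ∈ openSegment ℝ (y + ε • z) (y + ε • -z) :=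
    ⟨1 / 2, 1 / 2, by norm_num, by norm_num, by norm_num, by module⟩
  have := hy.2 h1 h2 hseg
  have h3 : ε • z = 0 := by simpa using this
  exact (smul_eq_zero.1 h3).resolve_left (ne_of_gt hε)

/-- If `D` is compact with `0` in its interior, every nonzero vector pairs negatively with some
extreme point of `D`: one that minimizes the pairing. -/
lemma exists_mem_extremePoints_dotProduct_neg {D : Set (Fin n → ℝ)} (hcomp : IsCompact D)
    (h0 : 0 ∈ interior D) {v : Fin n → ℝ} (hv : v ≠ 0) : ∃ y ∈ D.extremePoints ℝ, y ⬝ᵥ v < 0 := by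
  let f : (Fin n → ℝ) →L[ℝ] ℝ :=
    LinearMap.toContinuousLinearMap
      { toFun := fun y => -(y ⬝ᵥ v)
        map_add' := fun a b => by rw [add_dotProduct]; ring
        map_smul' := fun c a => by rw [smul_dotProduct]; simp }
  have hf : ∀ y, f y = -(y ⬝ᵥ v) := fun y => rfl
  obtain ⟨x, hx, hmax⟩ := hcomp.exists_isMaxOn ⟨0, interior_subset h0⟩ f.continuous.continuousOn
  have hexp : IsExposed ℝ D (f.toExposed D) := ContinuousLinearMap.toExposed.isExposed
  obtain ⟨y, hy⟩ := (hexp.isCompact hcomp).extremePoints_nonempty ⟨x, hx, fun z hz => hmax hz⟩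
  refine ⟨y, hexp.isExtreme.extremePoints_subset_extremePoints hy, ?_⟩
  obtain ⟨δ, hδ, hmem⟩ := exists_pos_neg_smul_mem h0 v
  have h1 := hy.1.2 _ hmem
  rw [hf, hf, neg_dotProduct, smul_dotProduct, smul_eq_mul] at h1
  have h2 : 0 < v ⬝ᵥ v := by
    refine lt_of_le_of_ne (Finset.sum_nonneg fun i _ => mul_self_nonneg _) fun h => hv ?_
    exact dotProduct_self_eq_zero.1 h.symm
  nlinarith

/-- A supporting hyperplane `{y = -1}` of `P` cuts out a facet as soon as no nonzero vector
is orthogonal to its intersection with `P`. -/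
lemma isFacet_setOf_dotProduct_eq (hn : 0 < n) {P : Set (Fin n → ℝ)} {y : Fin n → ℝ}
    (hy : ∀ p ∈ P, -1 ≤ y ⬝ᵥ p)
    (horth : ∀ z : Fin n → ℝ, (∀ p ∈ P, y ⬝ᵥ p = -1 → z ⬝ᵥ p = 0) → z = 0) :
    IsFacet P {p ∈ P | y ⬝ᵥ p = -1} := by
  set F := {p ∈ P | y ⬝ᵥ p = -1} with hF
  have hne : F.Nonempty := by
    by_contra hempty
    rw [Set.not_nonempty_iff_eq_empty] at hempty
    have h1 := horth (fun _ => 1) fun p hp hpy => by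
      have : p ∈ F := ⟨hp, hpy⟩
      simp [hempty] at this
    exact one_ne_zero (congrFun h1 ⟨0, hn⟩)
  obtain ⟨a, ha⟩ := hne
  let f : (Fin n → ℝ) →ₗ[ℝ] ℝ :=
    { toFun := fun p => y ⬝ᵥ p
      map_add' := fun a b => dotProduct_add _ _ _
      map_smul' := fun c a => dotProduct_smul _ _ _ }
  have hf : ∀ p, f p = y ⬝ᵥ p := fun p => rfl
  refine ⟨⟨a, ha⟩, fun _ => ⟨-LinearMap.toContinuousLinearMap f, ?_⟩, ?_⟩
  · ext p
    simp only [hF, Set.mem_ofPred_eq, neg_apply,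
      LinearMap.coe_toContinuousLinearMap', neg_le_neg_iff, hf]
    refine and_congr_right fun hp => ⟨fun h q hq => h ▸ hy q hq, fun h => ?_⟩
    exact le_antisymm (ha.2 ▸ h a ha.1) (hy p hp)
  · have hf0 : f ≠ 0 := by
      intro h
      have h1 : f a = 0 := by rw [h]; rfl
      rw [hf, ha.2] at h1
      norm_num at h1
    have hker := Module.Dual.finrank_ker_add_one_of_ne_zero (f := f) hf0
    rw [Module.finrank_fin_fun] at hker
    have hle : vectorSpan ℝ F ≤ LinearMap.ker f := by
      refine Submodule.span_le.2 ?_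
      rintro _ ⟨p, hp, q, hq, rfl⟩
      change p -ᵥ q ∈ LinearMap.ker f
      rw [LinearMap.mem_ker, vsub_eq_sub, map_sub, hf, hf, hp.2, hq.2, sub_self]
    have htop : vectorSpan ℝ F ⊔ Submodule.span ℝ {a} = ⊤ := by
      by_contra hlt
      obtain ⟨g, hg0, hg⟩ := Submodule.exists_le_ker_of_lt_top _ (lt_top_iff_ne_top.2 hlt)
      obtain ⟨z, hz⟩ := exists_eq_dotProduct g
      have hz0 : z = 0 := by
        refine horth z fun p hp hpy => ?_
        rw [← hz, ← sub_add_cancel p a]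
        refine hg (add_mem (Submodule.mem_sup_left ?_) (Submodule.mem_sup_right ?_))
        · exact vsub_mem_vectorSpan ℝ (show p ∈ F from ⟨hp, hpy⟩) ha
        · exact Submodule.mem_span_singleton_self a
      exact hg0 (LinearMap.ext fun x => by rw [hz, hz0, zero_dotProduct]; rfl)
    have h1 := Submodule.finrank_mono hle
    have h2 := Submodule.finrank_add_le_finrank_add_finrank (vectorSpan ℝ F)
      (Submodule.span ℝ {a})
    rw [htop, finrank_top, Module.finrank_fin_fun] at h2
    have h3 : Module.finrank ℝ (Submodule.span ℝ {a}) ≤ 1 :=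
      (finrank_span_le_card ({a} : Set (Fin n → ℝ))).trans (by simp)
    lia

/-- The inner normals of the facets of a rational polytope with `0` in its interior are not all
nonnegative at a nonzero vector. -/
lemma exists_isFacetDatum_pairing_neg (hn : 0 < n) {P : Set (Fin n → ℝ)}
    (hP : IsRationalPolytope P) (h0 : 0 ∈ interior P) {v : Fin n → ℝ} (hv : v ≠ 0) :
    ∃ F l a, IsFacetDatum P F l a ∧ pairing l v < 0 := by
  obtain ⟨S, hS⟩ := hP
  set T : Set (Fin n → ℝ) := ratToReal '' (S : Set (Fin n → ℚ)) with hT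
  replace hS : P = convexHull ℝ T := hS
  have hTfin : T.Finite := S.finite_toSet.image _
  have hTP : T ⊆ P := hS ▸ subset_convexHull ℝ T
  have hdual : dual T = dual P := by
    refine Set.Subset.antisymm (fun p hp q hq => ?_) fun p hp q hq => hp q (hTP hq)
    rw [hS] at hq
    exact le_dotProduct_of_mem_convexHull (mem_dual_iff.1 hp) hq
  have hcompP : IsCompact P := hS ▸ hTfin.isCompact_convexHull ℝ
  obtain ⟨y, hy, hyv⟩ := exists_mem_extremePoints_dotProduct_neg (D := dual P)
    (Metric.isCompact_of_isClosed_isBounded (isClosed_dual P) (isBounded_dual h0))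
    (zero_mem_interior_dual hcompP.isBounded) hv
  have hyP : ∀ p ∈ P, -1 ≤ y ⬝ᵥ p := fun p hp => by
    rw [dotProduct_comm]; exact mem_dual_iff.1 hy.1 p hp
  rw [← hdual] at hy
  have horth : ∀ z : Fin n → ℝ, (∀ s ∈ T, y ⬝ᵥ s = -1 → z ⬝ᵥ s = 0) → z = 0 := fun z hz =>
    eq_zero_of_mem_extremePoints_dual hTfin hy fun s hs h => by
      rw [dotProduct_comm] at h ⊢; exact hz s hs h
  obtain ⟨y', rfl⟩ := exists_eq_ratToReal
    (A := {s | s ∈ S ∧ y ⬝ᵥ ratToReal s = -1}) (y := y)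
    (fun z hz => horth z (by rintro _ ⟨s, hs, rfl⟩ h; exact hz s ⟨hs, h⟩))
    (fun s hs => ⟨-1, by rw [hs.2]; simp⟩)
  have hy0 : y' ≠ 0 := by
    rintro rfl
    simp [ratToReal, dotProduct] at hyv
  obtain ⟨l, a, ha, hl, hla⟩ := exists_isPrimitive_smul hy0
  have hpair : ∀ p, pairing l p = a * (ratToReal y' ⬝ᵥ p) := by
    intro p
    rw [pairing, dotProduct, Finset.mul_sum]
    refine Finset.sum_congr rfl fun i _ => ?_
    have : (l i : ℝ) = a * y' i := by exact_mod_cast congrArg (Rat.cast : ℚ → ℝ) (hla i)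
    rw [this, ratToReal, mul_assoc]
  have ha' : (0 : ℝ) < a := by exact_mod_cast ha
  refine ⟨{p ∈ P | ratToReal y' ⬝ᵥ p = -1}, l, a, ⟨?_, hl, fun p hp => ?_, ?_⟩, ?_⟩
  · exact isFacet_setOf_dotProduct_eq hn hyP fun z hz => horth z fun s hs => hz s (hTP hs)
  · rw [hpair]
    nlinarith [hyP p hp]
  · ext p
    refine and_congr_right fun _ => ?_
    rw [hpair, ← mul_neg_one (a : ℝ), mul_right_inj' ha'.ne']
  · rw [hpair]
    exact mul_neg_of_pos_of_neg ha' hyv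

theorem volumeBound_of_isRationalPolytope {P : Set (Fin n → ℝ)} (hP : IsRationalPolytope P)
    (h0 : 0 ∈ interior P)
    (hfacet : ∀ (F : Set (Fin n → ℝ)) (l : Fin n → ℤ) (a : ℚ), IsFacetDatum P F l a → a ≤ 1)
    (hbar : barycenter P = 0) : VolumeBound P := by
  obtain rfl | hn := Nat.eq_zero_or_pos n
  · exact volumeBound_zero _
  have hconv : Convex ℝ P := by
    obtain ⟨S, rfl⟩ := hP
    exact convex_convexHull ℝ _
  have hcomp : IsCompact P := by
    obtain ⟨S, rfl⟩ := hP
    exact (S.finite_toSet.image _).isCompact_convexHull ℝ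
  refine volumeBound_of_forms hn hconv hcomp h0 hbar {l | ∃ F a, IsFacetDatum P F l a}
    (fun l hl p hp => ?_) fun u hu => ?_
  · obtain ⟨F, a, h⟩ := hl
    have ha : (a : ℝ) ≤ 1 := by exact_mod_cast hfacet F l a h
    linarith [h.halfspace p hp]
  · by_contra hne
    obtain ⟨F, l, a, h, hneg⟩ := exists_isFacetDatum_pairing_neg hn hP h0 (v := toReal u)
      fun h => hne (toReal_injective (h.trans toReal_zero.symm))
    exact absurd (hu l ⟨F, a, h⟩) (not_le.2 hneg)

end Ehrhart


theorem corollary1p3 (n : ℕ) :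
    (∀ P : Set (Fin n → ℝ), Ehrhart.IsRationalPolytope P → 0 ∈ interior P →
      (∀ (F : Set (Fin n → ℝ)) (l : Fin n → ℤ) (a : ℚ), Ehrhart.IsFacetDatum P F l a → a ≤ 1) →
      Ehrhart.barycenter P = 0 → Ehrhart.VolumeBound P) ∧
    (∀ Q : Set (Fin n → ℝ), Ehrhart.IsLatticePolytope Q → 0 ∈ interior Q →
      Ehrhart.barycenter (Ehrhart.dual Q) = 0 → Ehrhart.VolumeBound (Ehrhart.dual Q)) ∧
    (∀ P : Set (Fin n → ℝ), Ehrhart.IsReflexive P →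
      Ehrhart.barycenter P = 0 → Ehrhart.VolumeBound P) :=
  ⟨fun _ hP h0 hfacet hbar => Ehrhart.volumeBound_of_isRationalPolytope hP h0 hfacet hbar,
    fun _ hQ h0 hbar => Ehrhart.volumeBound_dual hQ h0 hbar,
    fun _ hP hbar => Ehrhart.volumeBound_of_isReflexive hP hbar⟩
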